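/- Let $L$ be a finite (nonempty) lattice with least element $\hat 0$ and greatest element $\hat 1$, and let $\overline{L}=L\setminus\{\hat 0,\hat 1\}$ be its proper part. For a poset $P$, let $\Delta(P)$ denote its order complex, the simplicial complex whose faces are the finite chains of $P$. Let $\mathsf{Inf}(L)$ be the subposet of $\overline{L}$ consisting of those elements that are the meet in $L$ of a set of coatoms of $L$. For $x\in\overline{L}$ let $\epsilon(x)$ be the meet of all coatoms $c$ of $L$ with $x\le c$. Then $\epsilon$ is a closure operator on $\overline{L}$ (that is, a well-defined order-preserving map $\overline{L}\to\overline{L}$ with $x\le\epsilon(x)$ and $\epsilon(\epsilon(x))=\epsilon(x)$ for all $x$), its image is $\mathsf{Inf}(L)$, and the map $|\Delta(\overline{L})|\to|\Delta(\mathsf{Inf}(L))|$ of geometric realizations induced by $\epsilon$ is a homotopy equivalence. In particular, $\Delta(\overline{L})$ and $\Delta(\mathsf{Inf}(L))$ have the same homotopy type. -/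

import Mathlib

/-- The order complex `Δ(P)` of a poset `P`: the abstract simplicial complex with vertex set `P`
whose faces are the nonempty finite chains of `P`. -/
def orderComplex (P : Type*) [PartialOrder P] : AbstractSimplicialComplex P where
  faces := {s | s.Nonempty ∧ IsChain (· ≤ ·) (s : Set P)}
  isRelLowerSet_faces := fun _ hs =>
    ⟨hs.1, fun _ hts ht => ⟨ht, hs.2.mono (Finset.coe_subset.mpr hts)⟩⟩
  singleton_mem v := ⟨Finset.singleton_nonempty v, by simp⟩

/-- The geometric realization of an abstract simplicial complex on a finite vertex set `V`,
in barycentric coordinates: the functions `w : V → ℝ` that are nonnegative, have total weight `1`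
and whose support is a face. As a topological space it carries the subspace topology
from the finite-dimensional real vector space `V → ℝ`. -/
def geometricRealization {V : Type*} [Finite V] (K : AbstractSimplicialComplex V) :
    Set (V → ℝ) :=
  {w | (∀ v, 0 ≤ w v) ∧ ∑ᶠ v, w v = 1 ∧ ∃ s ∈ K.faces, Function.support w = (s : Set V)}

/-- The push-forward of weights along a map of finite sets: the weight of `y` is the sum of
the weights of the points of the fibre over `y`. -/
noncomputable def pushWeights {P Q : Type*} (f : P → Q) (w : P → ℝ) : Q → ℝ :=
  fun y => ∑ᶠ x : {x : P // f x = y}, w x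

theorem pushWeights_mem {P Q : Type*} [PartialOrder P] [PartialOrder Q] [Finite P] [Finite Q]
    (f : P →o Q) {w : P → ℝ} (hw : w ∈ geometricRealization (orderComplex P)) :
    pushWeights f w ∈ geometricRealization (orderComplex Q) := by
  classical
  have := Fintype.ofFinite P
  have := Fintype.ofFinite Q
  obtain ⟨h0, h1, s, ⟨hsne, hsch⟩, hs⟩ := hw
  have hpush : ∀ y, pushWeights f w y = ∑ x : {x : P // f x = y}, w x := fun y =>
    finsum_eq_sum_of_fintype _
  refine ⟨fun y => ?_, ?_, s.image f, ⟨hsne.image f, ?_⟩, ?_⟩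
  · rw [hpush]
    exact Finset.sum_nonneg fun x _ => h0 x
  · rw [finsum_eq_sum_of_fintype] at h1 ⊢
    simp only [hpush]
    rw [← h1]
    exact Fintype.sum_fiberwise f w
  · rw [Finset.coe_image]
    rintro _ ⟨a, ha, rfl⟩ _ ⟨b, hb, rfl⟩ hab
    have hne : a ≠ b := fun h => hab (congrArg f h)
    exact (hsch ha hb hne).imp (fun h => f.monotone h) (fun h => f.monotone h)
  · ext y
    rw [Function.mem_support, hpush, Ne,
      Finset.sum_eq_zero_iff_of_nonneg (fun (x : {x : P // f x = y}) _ => h0 x)]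
    have hmem : ∀ x, w x ≠ 0 ↔ x ∈ s := fun x => by
      rw [← Function.mem_support, hs, Finset.mem_coe]
    simp only [Finset.mem_univ, true_implies, Subtype.forall, not_forall, Finset.coe_image,
      Set.mem_image, Finset.mem_coe, ← hmem]
    exact ⟨fun ⟨x, hx, h⟩ => ⟨x, h, hx⟩, fun ⟨x, h, hx⟩ => ⟨x, hx, h⟩⟩

/-- The continuous map `|Δ(P)| → |Δ(Q)|` induced by a poset map `f : P → Q` of finite posets: the
affine extension, on each simplex, of the vertex map `f`. -/
noncomputable def orderComplexMap {P Q : Type*} [PartialOrder P] [PartialOrder Q]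
    [Finite P] [Finite Q] (f : P →o Q) :
    C(geometricRealization (orderComplex P), geometricRealization (orderComplex Q)) where
  toFun w := ⟨pushWeights f w.1, pushWeights_mem f w.2⟩
  continuous_toFun := by
    have := Fintype.ofFinite P
    refine Continuous.subtype_mk (continuous_pi fun y => ?_) _
    have := Fintype.ofFinite {x : P // f x = y}
    simp only [pushWeights, finsum_eq_sum_of_fintype]
    exact continuous_finsetSum _ fun x _ => (continuous_apply x.1).comp continuous_subtype_val

/-- The proper part of a bounded poset: all elements except the least and the greatest one. -/
abbrev ProperPart (L : Type*) [PartialOrder L] [BoundedOrder L] : Type _ :=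
  {x : L // x ≠ ⊥ ∧ x ≠ ⊤}

/-- `Inf(L)`: the subposet of the proper part of `L` consisting of those elements that are
the meet (taken in `L`) of a set of coatoms of `L`. -/
def infPoset (L : Type*) [Lattice L] [BoundedOrder L] : Set (ProperPart L) :=
  {x | ∃ S : Set L, (∀ c ∈ S, IsCoatom c) ∧ IsGLB S (x : L)}

/-! A coatom lies above `x` exactly when it lies above `ε x`, which makes `ε` a closure operator;
its fixed points are the meets of coatoms. The inclusion of `Inf(L)` is then a homotopy inverse: one
composite is the identity, and the other dominates it pointwise, so
`orderComplexMap_homotopic_of_le` applies. When `f ≤ g`, the images of a chain under `f` and `g`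
need not together form a chain, so a single straight-line homotopy may leave the realization.
Instead `f` is changed into `g` one point at a time from the top, and each change is a contiguity.
-/

/-- A point of the realization of an order complex is a probability weight supported on a chain. -/
theorem mem_geometricRealization_orderComplex {P : Type*} [PartialOrder P] [Finite P]
    {w : P → ℝ} : w ∈ geometricRealization (orderComplex P) ↔
      (∀ v, 0 ≤ w v) ∧ ∑ᶠ v, w v = 1 ∧ IsChain (· ≤ ·) (Function.support w) := by
  constructor
  · rintro ⟨h0, h1, s, hs, hsw⟩
    exact ⟨h0, h1, hsw ▸ hs.2⟩
  · rintro ⟨h0, h1, hc⟩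
    have hfin : (Function.support w).Finite := Set.toFinite _
    refine ⟨h0, h1, hfin.toFinset, ⟨?_, by simpa using hc⟩, by simp⟩
    rw [Set.Finite.toFinset_nonempty, Function.support_nonempty_iff]
    rintro rfl
    simp at h1

theorem pushWeights_eq_sum {P Q : Type*} [Fintype P] [DecidableEq Q] (f : P → Q) (w : P → ℝ)
    (y : Q) : pushWeights f w y = ∑ x, if f x = y then w x else 0 := by
  rw [pushWeights, finsum_eq_sum_of_fintype, ← Finset.sum_filter]
  exact (Finset.sum_subtype _ (by simp) w).symm

theorem pushWeights_id {P : Type*} [Finite P] (w : P → ℝ) : pushWeights id w = w := by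
  classical
  have := Fintype.ofFinite P
  ext y
  simp [pushWeights_eq_sum]

theorem pushWeights_comp {P Q R : Type*} [Finite P] [Finite Q] (g : Q → R) (f : P → Q)
    (w : P → ℝ) : pushWeights g (pushWeights f w) = pushWeights (g ∘ f) w := by
  classical
  have := Fintype.ofFinite P
  have := Fintype.ofFinite Q
  ext z
  simp only [pushWeights_eq_sum, Function.comp_apply]
  simp_rw [← Finset.sum_filter (p := fun y => g y = z)]
  rw [Finset.sum_comm]
  refine Finset.sum_congr rfl fun x _ => ?_
  simp [Finset.sum_ite_eq]

theorem exists_of_pushWeights_ne_zero {P Q : Type*} [Finite P] {f : P → Q} {w : P → ℝ} {y : Q}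
    (h : pushWeights f w y ≠ 0) : ∃ x, f x = y ∧ w x ≠ 0 := by
  by_contra! hcon
  exact h (finsum_eq_zero_of_forall_eq_zero fun x => hcon x.1 x.2)

theorem orderComplexMap_id {P : Type*} [PartialOrder P] [Finite P] :
    orderComplexMap (OrderHom.id : P →o P) = ContinuousMap.id _ := by
  ext1 w
  exact Subtype.ext (pushWeights_id w.1)

theorem orderComplexMap_comp {P Q R : Type*} [PartialOrder P] [PartialOrder Q] [PartialOrder R]
    [Finite P] [Finite Q] [Finite R] (g : Q →o R) (f : P →o Q) :
    (orderComplexMap g).comp (orderComplexMap f) = orderComplexMap (g.comp f) := by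
  ext1 w
  exact Subtype.ext (pushWeights_comp g f w.1)

/-- Contiguous order-preserving maps induce homotopic maps, by the straight-line homotopy. -/
theorem orderComplexMap_homotopic_of_contiguous {P Q : Type*} [PartialOrder P] [PartialOrder Q]
    [Finite P] [Finite Q] (f g : P →o Q)
    (h : ∀ x y, x ≤ y ∨ y ≤ x → f x ≤ g y ∨ g y ≤ f x) :
    (orderComplexMap f).Homotopic (orderComplexMap g) := by
  have hmem : ∀ (t : unitInterval) (w : geometricRealization (orderComplex P)),
      (fun y => (1 - (t : ℝ)) * pushWeights f w.1 y + t * pushWeights g w.1 y) ∈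
        geometricRealization (orderComplex Q) := by
    intro t w
    obtain ⟨hf0, hf1, hfc⟩ :=
      mem_geometricRealization_orderComplex.mp (pushWeights_mem f w.2)
    obtain ⟨hg0, hg1, hgc⟩ :=
      mem_geometricRealization_orderComplex.mp (pushWeights_mem g w.2)
    have hwc := (mem_geometricRealization_orderComplex.mp w.2).2.2
    refine mem_geometricRealization_orderComplex.mpr ⟨fun y => ?_, ?_, ?_⟩
    · exact add_nonneg (mul_nonneg (sub_nonneg.mpr t.2.2) (hf0 y)) (mul_nonneg t.2.1 (hg0 y))
    · rw [finsum_add_distrib (Set.toFinite _) (Set.toFinite _),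
        ← mul_finsum' _ _ (Set.toFinite _), ← mul_finsum' _ _ (Set.toFinite _), hf1, hg1]
      ring
    -- Contiguity enters here: the segment stays in the realization because the two image chains of
    -- the support of `w` are comparable with each other.
    · have hfg : ∀ a b, pushWeights f w.1 a ≠ 0 → pushWeights g w.1 b ≠ 0 → a ≤ b ∨ b ≤ a := by
        intro a b ha hb
        obtain ⟨x, rfl, hx⟩ := exists_of_pushWeights_ne_zero ha
        obtain ⟨y, rfl, hy⟩ := exists_of_pushWeights_ne_zero hb
        exact h x y (hwc.total hx hy)
      have hsupp : ∀ a, (1 - (t : ℝ)) * pushWeights f w.1 a + t * pushWeights g w.1 a ≠ 0 →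
          pushWeights f w.1 a ≠ 0 ∨ pushWeights g w.1 a ≠ 0 := by
        intro a ha
        by_contra! hcon
        simp [hcon.1, hcon.2] at ha
      intro a ha b hb _
      rcases hsupp a ha with ha | ha <;> rcases hsupp b hb with hb | hb
      · exact hfc.total ha hb
      · exact hfg a b ha hb
      · exact (hfg b a hb ha).symm
      · exact hgc.total ha hb
  refine ⟨{ toFun := fun p => ⟨_, hmem p.1 p.2⟩
            continuous_toFun := ?_
            map_zero_left := fun w => ?_
            map_one_left := fun w => ?_ }⟩
  · refine Continuous.subtype_mk (continuous_pi fun y => ?_) _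
    have key : ∀ k : P →o Q, Continuous fun p : unitInterval ×
        geometricRealization (orderComplex P) => pushWeights k p.2.1 y := fun k =>
      (continuous_apply y).comp
        (continuous_subtype_val.comp ((orderComplexMap k).continuous.comp continuous_snd))
    have ht : Continuous fun p : unitInterval × geometricRealization (orderComplex P) =>
        (p.1 : ℝ) := continuous_subtype_val.comp continuous_fst
    exact ((continuous_const.sub ht).mul (key f)).add (ht.mul (key g))
  · refine Subtype.ext (funext fun y => ?_)
    simp [orderComplexMap]
  · refine Subtype.ext (funext fun y => ?_)
    simp [orderComplexMap]

/-- Quillen's order homotopy lemma for finite posets: comparable maps are homotopic. -/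
theorem orderComplexMap_homotopic_of_le {P Q : Type*} [PartialOrder P] [PartialOrder Q]
    [Finite P] [Finite Q] (f g : P →o Q) (hfg : f ≤ g) :
    (orderComplexMap f).Homotopic (orderComplexMap g) := by
  classical
  induction hn : {x | f x ≠ g x}.ncard using Nat.strong_induction_on generalizing f with
  | _ n ih =>
  obtain hempty | hne := {x | f x ≠ g x}.eq_empty_or_nonempty
  · have : f = g := by
      ext x
      by_contra hx
      exact (Set.eq_empty_iff_forall_notMem.mp hempty x) hx
    rw [this]
  -- Maximality of `a` gives `f = g` strictly above it, so raising the value at `a` to `g a`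
  -- preserves monotonicity.
  obtain ⟨a, ha⟩ := (Set.toFinite {x | f x ≠ g x}).exists_maximal hne
  have hbelow : ∀ x, x ≤ a → f x ≤ g a := fun x hx => (f.monotone hx).trans (hfg a)
  have habove : ∀ y, a < y → f y = g y := fun y hy => by
    by_contra hcon
    exact ha.not_gt hcon hy
  have habove' : ∀ y, a < y → g a ≤ f y := fun y hy => habove y hy ▸ g.monotone hy.le
  let k : P →o Q :=
    { toFun := Function.update f a (g a)
      monotone' := by
        intro x y hxy
        by_cases hx : x = a <;> by_cases hy : y = a
        · rw [hx, hy]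
        · simpa [hx, hy] using habove' y ((hx ▸ hxy).lt_of_ne (Ne.symm hy))
        · simpa [hx, hy] using hbelow x (hy ▸ hxy)
        · simpa [hx, hy] using f.monotone hxy }
  have hka : k a = g a := Function.update_self a (g a) f
  have hkne : ∀ x, x ≠ a → k x = f x := fun x hx => Function.update_of_ne hx (g a) f
  have hkg : k ≤ g := by
    intro x
    rcases eq_or_ne x a with rfl | hx
    · exact hka.le
    · exact (hkne x hx).trans_le (hfg x)
  have hlt : {x | k x ≠ g x}.ncard < n := by
    rw [← hn]
    refine Set.ncard_lt_ncard (Set.ssubset_iff_of_subset ?_ |>.mpr ⟨a, ha.prop, ?_⟩) (Set.toFinite _)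
    · intro x hx
      have hxa : x ≠ a := fun h => hx (h ▸ hka)
      simpa [hkne x hxa] using hx
    · simp [hka]
  refine (orderComplexMap_homotopic_of_contiguous f k fun x y hxy => ?_).trans
    (ih _ hlt k hkg rfl)
  -- The maps `f` and `k` differ only at `a`, so only the value `k a = g a` needs an argument.
  rcases eq_or_ne y a with rfl | hy
  · rw [hka]
    by_cases hx : x ≤ y
    · exact Or.inl (hbelow x hx)
    · exact Or.inr (habove' x ((hxy.resolve_left hx).lt_of_not_ge hx))
  · rw [hkne y hy]
    exact hxy.imp (fun h => f.monotone h) fun h => f.monotone h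

/-- An order-preserving map onto a subposet that fixes the subposet and is inflationary induces
a homotopy equivalence of order complexes. -/
theorem exists_homotopyEquiv_of_retraction {P : Type*} [PartialOrder P] [Finite P] {S : Set P}
    (f : P →o S) (hle : ∀ x, x ≤ f x) (hfix : ∀ x : S, f x = x) :
    ∃ e : ContinuousMap.HomotopyEquiv (geometricRealization (orderComplex P))
      (geometricRealization (orderComplex S)), ∀ p, e p = orderComplexMap f p := by
  let i : S →o P := ⟨Subtype.val, fun _ _ h => h⟩
  refine ⟨⟨orderComplexMap f, orderComplexMap i, ?_, ?_⟩, fun _ => rfl⟩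
  · rw [orderComplexMap_comp, ← orderComplexMap_id]
    exact (orderComplexMap_homotopic_of_le _ _ hle).symm
  · rw [orderComplexMap_comp, ← orderComplexMap_id]
    have : f.comp i = OrderHom.id := OrderHom.ext _ _ (funext hfix)
    rw [this]

theorem exists_isGLB_coatoms {L : Type*} [Lattice L] [BoundedOrder L] [Finite L] (x : L) :
    ∃ m, IsGLB {c : L | IsCoatom c ∧ x ≤ c} m := by
  have hfin : {c : L | IsCoatom c ∧ x ≤ c}.Finite := Set.toFinite _
  exact ⟨hfin.toFinset.inf id, by simpa using Finset.isGLB_inf_id (s := hfin.toFinset)⟩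

theorem mainTheorem4 (L : Type*) [Lattice L] [BoundedOrder L] [Finite L] :
    ∃ ε : ClosureOperator (ProperPart L),
      (∀ x : ProperPart L, IsGLB {c : L | IsCoatom c ∧ (x : L) ≤ c} (ε x : L)) ∧
      Set.range ε = infPoset L ∧
      ∃ f : ProperPart L →o infPoset L,
        (∀ x, (f x : ProperPart L) = ε x) ∧
        ∃ e : ContinuousMap.HomotopyEquiv
            (geometricRealization (orderComplex (ProperPart L)))
            (geometricRealization (orderComplex (infPoset L))),
          ∀ p, e p = orderComplexMap f p := by
  choose m hm using exists_isGLB_coatoms (L := L)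
  have hle : ∀ x, x ≤ m x := fun x => (hm x).2 fun c hc => hc.2
  have hmc : ∀ x c, IsCoatom c → x ≤ c → m x ≤ c := fun x c hc hxc => (hm x).1 ⟨hc, hxc⟩
  have hproper : ∀ x : ProperPart L, m x ≠ ⊥ ∧ m x ≠ ⊤ := by
    intro x
    refine ⟨fun h => x.2.1 (le_bot_iff.mp ((hle x).trans h.le)), fun h => ?_⟩
    -- Finiteness puts a coatom above `x`, so the meet is not the empty meet `⊤`.
    obtain ⟨c, hc, hxc⟩ := (eq_top_or_exists_le_coatom (x : L)).resolve_left x.2.2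
    exact hc.1 (top_le_iff.mp (h.ge.trans (hmc x c hc hxc)))
  let ε : ClosureOperator (ProperPart L) := ClosureOperator.mk'
    (fun x => ⟨m x, hproper x⟩)
    (fun x y hxy => (hm y).2 fun c hc => hmc x c hc.1 (le_trans hxy hc.2))
    (fun x => hle x)
    (fun x => (hm x).2 fun c hc => hmc _ c hc.1 (hmc x c hc.1 hc.2))
  have hmem : ∀ x, ε x ∈ infPoset L := fun x => ⟨_, fun c hc => hc.1, hm x⟩
  have hfix : ∀ x ∈ infPoset L, ε x = x := by
    rintro x ⟨S, hS, hx⟩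
    refine le_antisymm ?_ (ε.le_closure x)
    -- Every member of `S` is a coatom above `x`, so `m x` is a lower bound of `S`, whose meet is
    -- `x`.
    exact hx.2 fun c hc => hmc x c (hS c hc) (hx.1 hc)
  let f : ProperPart L →o infPoset L := ⟨fun x => ⟨ε x, hmem x⟩, fun _ _ h => ε.monotone h⟩
  refine ⟨ε, fun x => hm x, ?_, f, fun _ => rfl,
    exists_homotopyEquiv_of_retraction f (fun x => ε.le_closure x)
      fun x => Subtype.ext (hfix x x.2)⟩
  exact Set.Subset.antisymm (Set.range_subset_iff.mpr hmem) fun x hx => ⟨x, hfix x hx⟩
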